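/- Let $n\in\{2,3\}$ and let $\Omega\subset\mathbb{R}^n$ be a bounded open set. Let $H_0^1(\Omega)$ be the closure of $C_c^\infty(\Omega)$ in $H^1(\Omega)$. Let $a_0\in L^\infty(\Omega)$ with $a_0\ge 0$ a.e. in $\Omega$, and let $a_{ij}=a_{ji}\in C^{0,1}(\overline\Omega)$ ($1\le i,j\le n$) satisfy, for some $\alpha>0$, $\sum_{i,j}a_{ij}(x)\xi_i\xi_j\ge\alpha|\xi|^2$ for all $x\in\Omega$, $\xi\in\mathbb{R}^n$. Put $$a(z,v)=\sum_{i,j=1}^n\int_\Omega a_{ij}\,\partial_{x_i}z\,\partial_{x_j}v\,dx+\int_\Omega a_0zv\,dx ,$$ and for $\eta\in L^2(\Omega)$ let $S\eta\in H_0^1(\Omega)$ be the unique $y\in H_0^1(\Omega)$ with $a(y,v)=(\eta,v)_{L^2(\Omega)}$ for all $v\in H_0^1(\Omega)$. Let $\Gamma\subset\Omega$ be a $C^2$-hypersurface (locally the zero set of a $C^2$ function with non-vanishing gradient on $\Gamma$; it may be open and may have several components) such that $\Gamma\subset\partial U$ for some open set $U\subset\Omega$ with Lipschitz boundary. Let $L^2(\Gamma)$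 be taken with respect to the $(n-1)$-dimensional surface measure, and let $y\mapsto y|_\Gamma$ be the trace, i.e. the unique continuous linear operator $H_0^1(\Omega)\to L^2(\Gamma)$ that is the pointwise restriction on $H_0^1(\Omega)\cap C(\Omega)$. Let $g_\Gamma\in L^2(\Gamma)$, $\nu>0$, and let either $a,b\in\mathbb{R}$ with $a<b$, or $a=-\infty$, $b=\infty$. Put $$U_{ad}=\{\eta\in L^2(\Omega): a\le\eta\le b\ \text{a.e. in }\Omega\},\qquad \hat J(\eta)=\tfrac12\|(S\eta)|_\Gamma-g_\Gamma\|_{L^2(\Gamma)}^2+\tfrac{\nu}{2}\|\eta\|_{L^2(\Omega)}^2 .$$ If $u\in U_{ad}$ minimises $\hat J$ over $U_{ad}$, then $u\in H^1(\Omega)$; and if moreover $a\le 0\le b$ (that is, the control $0$ is within the bounds), then $u\in H_0^1(\Omega)$. -/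

import Mathlib

open MeasureTheory Set
open scoped ContDiff RealInnerProductSpace

namespace SurfaceControl

/-- `ℝⁿ` with the Euclidean norm. -/
abbrev E (n : ℕ) : Type := EuclideanSpace ℝ (Fin n)

/-- Lebesgue measure on `Ω`. -/
noncomputable abbrev vol {n : ℕ} (Ω : Set (E n)) : Measure (E n) := volume.restrict Ω

/-- The real Hilbert space `L²(Ω)`. -/
abbrev L2 {n : ℕ} (Ω : Set (E n)) : Type := Lp ℝ 2 (vol Ω)

/-- The surface measure `dA` on `Γ`: the `(n-1)`-dimensional Hausdorff measure, normalised so that it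
is the usual area (Lebesgue measure on hyperplanes), restricted to `Γ`. -/
noncomputable abbrev surf {n : ℕ} (Γ : Set (E n)) : Measure (E n) :=
  (Measure.euclideanHausdorffMeasure (n - 1)).restrict Γ

/-- The real Hilbert space `L²(Γ)`. -/
abbrev L2surf {n : ℕ} (Γ : Set (E n)) : Type := Lp ℝ 2 (surf Γ)

/-! ### Sobolev spaces -/

/-- `φ ∈ C_c^∞(Ω)`. -/
structure IsTest {n : ℕ} (Ω : Set (E n)) (φ : E n → ℝ) : Prop where
  smooth : ContDiff ℝ ∞ φ
  compact : HasCompactSupport φ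
  support : tsupport φ ⊆ Ω

/-- The classical partial derivative `∂φ/∂x_i`. -/
noncomputable def partialDeriv {n : ℕ} (i : Fin n) (φ : E n → ℝ) (x : E n) : ℝ :=
  fderiv ℝ φ x (EuclideanSpace.single i 1)

/-- `g` is the weak derivative of `f` with respect to `x_i` on `Ω`. -/
def IsWeakDeriv {n : ℕ} (Ω : Set (E n)) (i : Fin n) (f g : L2 Ω) : Prop :=
  ∀ φ : E n → ℝ, IsTest Ω φ →
    ∫ x in Ω, f x * partialDeriv i φ x = - ∫ x in Ω, g x * φ x

theorem IsTest.zero {n : ℕ} (Ω : Set (E n)) : IsTest Ω (0 : E n → ℝ) :=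
  ⟨contDiff_const, HasCompactSupport.zero, by simp [tsupport]⟩

theorem IsTest.add {n : ℕ} {Ω : Set (E n)} {φ ψ : E n → ℝ} (hφ : IsTest Ω φ) (hψ : IsTest Ω ψ) :
    IsTest Ω (φ + ψ) :=
  ⟨hφ.smooth.add hψ.smooth, hφ.compact.add hψ.compact,
    (tsupport_add φ ψ).trans (union_subset hφ.support hψ.support)⟩

theorem IsTest.smul {n : ℕ} {Ω : Set (E n)} {φ : E n → ℝ} (c : ℝ) (hφ : IsTest Ω φ) :
    IsTest Ω (c • φ) :=
  ⟨hφ.smooth.const_smul c, hφ.compact.smul_left (f := fun _ => c),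
    (closure_mono (Function.support_const_smul_subset c φ)).trans hφ.support⟩

theorem IsTest.integrable_mul {n : ℕ} {Ω : Set (E n)} {φ : E n → ℝ} (hφ : IsTest Ω φ) (f : L2 Ω) :
    Integrable (fun x => f x * φ x) (vol Ω) :=
  MemLp.integrable_mul (p := 2) (q := 2) (Lp.memLp f)
    ((hφ.smooth.continuous.memLp_of_hasCompactSupport hφ.compact).restrict Ω)

theorem IsTest.integrable_mul_partialDeriv {n : ℕ} {Ω : Set (E n)} {φ : E n → ℝ}
    (hφ : IsTest Ω φ) (f : L2 Ω) (i : Fin n) :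
    Integrable (fun x => f x * partialDeriv i φ x) (vol Ω) := by
  have hc : Continuous (partialDeriv i φ) :=
    (hφ.smooth.continuous_fderiv (by simp)).clm_apply continuous_const
  have hs : HasCompactSupport (partialDeriv i φ) := hφ.compact.fderiv_apply (𝕜 := ℝ) _
  exact MemLp.integrable_mul (p := 2) (q := 2) (Lp.memLp f)
    ((hc.memLp_of_hasCompactSupport hs).restrict Ω)

theorem IsWeakDeriv.zero {n : ℕ} (Ω : Set (E n)) (i : Fin n) : IsWeakDeriv Ω i 0 0 := by
  intro φ _
  have h : ∀ ψ : E n → ℝ, ∫ x in Ω, (0 : L2 Ω) x * ψ x = 0 := by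
    intro ψ
    refine integral_eq_zero_of_ae ?_
    filter_upwards [Lp.coeFn_zero ℝ 2 (vol Ω)] with x hx
    rw [hx]
    simp
  rw [h, h, neg_zero]

theorem IsWeakDeriv.add {n : ℕ} {Ω : Set (E n)} {i : Fin n} {f g f' g' : L2 Ω}
    (h : IsWeakDeriv Ω i f g) (h' : IsWeakDeriv Ω i f' g') :
    IsWeakDeriv Ω i (f + f') (g + g') := by
  intro φ hφ
  have e1 : ∫ x in Ω, (f + f') x * partialDeriv i φ x
      = ∫ x in Ω, (f x * partialDeriv i φ x + f' x * partialDeriv i φ x) := by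
    refine integral_congr_ae ?_
    filter_upwards [Lp.coeFn_add f f'] with x hx
    rw [hx, Pi.add_apply, add_mul]
  have e2 : ∫ x in Ω, (g + g') x * φ x = ∫ x in Ω, (g x * φ x + g' x * φ x) := by
    refine integral_congr_ae ?_
    filter_upwards [Lp.coeFn_add g g'] with x hx
    rw [hx, Pi.add_apply, add_mul]
  rw [e1, e2, integral_add (hφ.integrable_mul_partialDeriv f i) (hφ.integrable_mul_partialDeriv f' i),
    integral_add (hφ.integrable_mul g) (hφ.integrable_mul g'), h φ hφ, h' φ hφ, neg_add]

theorem IsWeakDeriv.smul {n : ℕ} {Ω : Set (E n)} {i : Fin n} {f g : L2 Ω} (c : ℝ)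
    (h : IsWeakDeriv Ω i f g) : IsWeakDeriv Ω i (c • f) (c • g) := by
  intro φ hφ
  have e1 : ∫ x in Ω, (c • f) x * partialDeriv i φ x
      = ∫ x in Ω, c * (f x * partialDeriv i φ x) := by
    refine integral_congr_ae ?_
    filter_upwards [Lp.coeFn_smul c f] with x hx
    rw [hx, Pi.smul_apply, smul_eq_mul, mul_assoc]
  have e2 : ∫ x in Ω, (c • g) x * φ x = ∫ x in Ω, c * (g x * φ x) := by
    refine integral_congr_ae ?_
    filter_upwards [Lp.coeFn_smul c g] with x hx
    rw [hx, Pi.smul_apply, smul_eq_mul, mul_assoc]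
  rw [e1, e2, integral_const_mul, integral_const_mul, h φ hφ, mul_neg]

/-- The Hilbert space of pairs `(f, (g_1, …, g_n))` of `L²(Ω)` functions, with
`‖(f, g)‖² = ‖f‖² + ∑ i, ‖g_i‖²`. -/
abbrev Pair {n : ℕ} (Ω : Set (E n)) : Type :=
  WithLp 2 (L2 Ω × PiLp 2 (fun _ : Fin n => L2 Ω))

/-- The Sobolev space `H¹(Ω)`, each function being stored with its weak gradient (which it
determines when `Ω` is open); the norm is the usual
`‖y‖² = ‖y‖²_{L²(Ω)} + ∑ i, ‖∂_i y‖²_{L²(Ω)}`. -/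
noncomputable def H1 {n : ℕ} (Ω : Set (E n)) : Submodule ℝ (Pair Ω) where
  carrier := {p | ∀ i, IsWeakDeriv Ω i p.fst (p.snd i)}
  zero_mem' := fun i => IsWeakDeriv.zero Ω i
  add_mem' := fun hp hq i => (hp i).add (hq i)
  smul_mem' := fun c _ hp i => (hp i).smul c

/-- The `L²` function underlying an element of `H¹(Ω)`. -/
noncomputable def toL2 {n : ℕ} {Ω : Set (E n)} (y : H1 Ω) : L2 Ω := (y : Pair Ω).fst

/-- The weak derivative `∂_i y ∈ L²(Ω)` of `y ∈ H¹(Ω)`. -/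
noncomputable def weakDeriv {n : ℕ} {Ω : Set (E n)} (y : H1 Ω) (i : Fin n) : L2 Ω := (y : Pair Ω).snd i

/-- `C_c^∞(Ω)` as a subspace of `H¹(Ω)`. -/
noncomputable def testSubmodule {n : ℕ} (Ω : Set (E n)) : Submodule ℝ (H1 Ω) where
  carrier := {y | ∃ φ : E n → ℝ, IsTest Ω φ ∧ toL2 y =ᵐ[vol Ω] φ}
  zero_mem' := ⟨0, IsTest.zero Ω, Lp.coeFn_zero ℝ 2 (vol Ω)⟩
  add_mem' := by
    rintro y z ⟨φ, hφ, hy⟩ ⟨ψ, hψ, hz⟩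
    exact ⟨φ + ψ, hφ.add hψ, (Lp.coeFn_add (toL2 y) (toL2 z)).trans (hy.add hz)⟩
  smul_mem' := by
    rintro c y ⟨φ, hφ, hy⟩
    exact ⟨c • φ, hφ.smul c, (Lp.coeFn_smul c (toL2 y)).trans (hy.const_smul c)⟩

/-- The Sobolev space `H_0^1(Ω)`: the closure of `C_c^∞(Ω)` in `H¹(Ω)`. -/
noncomputable def H10 {n : ℕ} (Ω : Set (E n)) : Submodule ℝ (H1 Ω) := (testSubmodule Ω).topologicalClosure

/-- `u ∈ L²(Ω)` belongs to `H¹(Ω)`. -/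
def MemH1 {n : ℕ} {Ω : Set (E n)} (u : L2 Ω) : Prop := ∃ y : H1 Ω, toL2 y = u

/-- `u ∈ L²(Ω)` belongs to `H_0^1(Ω)`. -/
def MemH10 {n : ℕ} {Ω : Set (E n)} (u : L2 Ω) : Prop := ∃ y : H1 Ω, y ∈ H10 Ω ∧ toL2 y = u

/-! ### The elliptic operator and the control-to-state operator -/

/-- The assumptions on the coefficients of
`A z = - ∑ i j, ∂_j (a_{ij} ∂_i z) + a₀ z`: `a₀ ∈ L^∞(Ω)`, `a₀ ≥ 0` a.e.,
`a_{ij} = a_{ji} ∈ C^{0,1}(Ω̄)`, and uniform ellipticity on `Ω`. -/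
structure IsElliptic {n : ℕ} (Ω : Set (E n)) (A : Fin n → Fin n → E n → ℝ) (a₀ : E n → ℝ) :
    Prop where
  bounded : MemLp a₀ ⊤ (vol Ω)
  nonneg : ∀ᵐ x ∂(vol Ω), 0 ≤ a₀ x
  symm : ∀ i j, ∀ x ∈ closure Ω, A i j x = A j i x
  lipschitz : ∀ i j, ∃ K, LipschitzOnWith K (A i j) (closure Ω)
  elliptic : ∃ α : ℝ, 0 < α ∧ ∀ x ∈ Ω, ∀ ξ : E n,
    α * ‖ξ‖ ^ 2 ≤ ∑ i, ∑ j, A i j x * ξ i * ξ j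

/-- The bilinear form
`a(z,v) = ∑ i j, ∫_Ω a_{ij} ∂_i z ∂_j v dx + ∫_Ω a₀ z v dx`. -/
noncomputable def bilin {n : ℕ} {Ω : Set (E n)} (A : Fin n → Fin n → E n → ℝ) (a₀ : E n → ℝ)
    (z v : H1 Ω) : ℝ :=
  (∑ i, ∑ j, ∫ x in Ω, A i j x * weakDeriv z i x * weakDeriv v j x) + ∫ x in Ω, a₀ x * toL2 z x * toL2 v x

/-- `y ∈ H_0^1(Ω)` is the weak solution of `A y = η` in `Ω`, `y = 0` on `∂Ω`. -/
def IsState {n : ℕ} {Ω : Set (E n)} (A : Fin n → Fin n → E n → ℝ) (a₀ : E n → ℝ)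
    (η : L2 Ω) (y : H10 Ω) : Prop :=
  ∀ v : H10 Ω, bilin A a₀ (y : H1 Ω) (v : H1 Ω) = ⟪η, toL2 (v : H1 Ω)⟫

/-- The control-to-state operator `S`: `S η` is the weak solution `y ∈ H_0^1(Ω)`, which exists and
is unique for elliptic coefficients on a bounded open set. -/
noncomputable def controlToState {n : ℕ} {Ω : Set (E n)} (A : Fin n → Fin n → E n → ℝ)
    (a₀ : E n → ℝ) (η : L2 Ω) : H10 Ω :=
  Classical.epsilon (IsState A a₀ η)

/-! ### The hypersurface and the trace -/

/-- `Γ` is a `C²`-hypersurface in `ℝⁿ` (possibly with several components, and possibly open, i.e. not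
closed as a set): locally the zero set of a `C²` function whose gradient does not vanish on `Γ`. -/
def IsC2Hypersurface {n : ℕ} (Γ : Set (E n)) : Prop :=
  ∀ x₀ ∈ Γ, ∃ V : Set (E n), IsOpen V ∧ x₀ ∈ V ∧ ∃ φ : E n → ℝ, ContDiffOn ℝ 2 φ V ∧
    (∀ x ∈ Γ ∩ V, fderiv ℝ φ x ≠ 0) ∧ V ∩ Γ = {x ∈ V | φ x = 0}

/-- `U` has a Lipschitz boundary: near each boundary point there is a unit direction `e` such that
`U` is the set of points lying strictly below the graph of a Lipschitz function over the
hyperplane orthogonal to `e`. -/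
def HasLipschitzBoundary {n : ℕ} (U : Set (E n)) : Prop :=
  ∀ x₀ ∈ frontier U, ∃ V : Set (E n), IsOpen V ∧ x₀ ∈ V ∧
    ∃ e : E n, ‖e‖ = 1 ∧ ∃ γ : E n → ℝ, (∃ K, LipschitzWith K γ) ∧
      ∀ x ∈ V, x ∈ U ↔ ⟪e, x⟫ < γ (x - ⟪e, x⟫ • e)

/-- The assumptions on `Γ`: a `C²`-hypersurface contained in `Ω` and in the boundary of an open set
`U ⊆ Ω` with Lipschitz boundary. -/
def IsAdmissibleSurface {n : ℕ} (Ω Γ : Set (E n)) : Prop :=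
  IsC2Hypersurface Γ ∧ Γ ⊆ Ω ∧
    ∃ U : Set (E n), IsOpen U ∧ U ⊆ Ω ∧ HasLipschitzBoundary U ∧ Γ ⊆ frontier U

/-- `T` is the trace operator `y ↦ y|_Γ`: it is continuous and linear from `H_0^1(Ω)` to `L²(Γ)`,
and `T y` is the pointwise restriction of `y` for every `y ∈ H_0^1(Ω) ∩ C(Ω)`. -/
def IsTraceOp {n : ℕ} {Ω Γ : Set (E n)} (T : H10 Ω →L[ℝ] L2surf Γ) : Prop :=
  ∀ (y : H10 Ω) (w : E n → ℝ), ContinuousOn w Ω → toL2 (y : H1 Ω) =ᵐ[vol Ω] w →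
    T y =ᵐ[surf Γ] w

/-- The trace operator `y ↦ y|_Γ`. For an admissible surface it exists, and it is unique because
`C_c^∞(Ω)` is dense in `H_0^1(Ω)`. -/
noncomputable def trace {n : ℕ} (Ω Γ : Set (E n)) : H10 Ω →L[ℝ] L2surf Γ :=
  Classical.epsilon IsTraceOp

/-! ### The optimal control problem -/

/-- The objective `J(y,η) = ½ ‖y|_Γ - g‖²_{L²(Γ)} + (ν/2) ‖η‖²_{L²(Ω)}`. -/
noncomputable def objective {n : ℕ} {Ω Γ : Set (E n)} (g : L2surf Γ) (ν : ℝ)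
    (y : H10 Ω) (η : L2 Ω) : ℝ :=
  1 / 2 * ‖trace Ω Γ y - g‖ ^ 2 + ν / 2 * ‖η‖ ^ 2

/-- The reduced objective `Ĵ(η) = J(S η, η)`. -/
noncomputable def reducedObjective {n : ℕ} {Ω Γ : Set (E n)} (A : Fin n → Fin n → E n → ℝ)
    (a₀ : E n → ℝ) (g : L2surf Γ) (ν : ℝ) (η : L2 Ω) : ℝ :=
  objective g ν (controlToState A a₀ η) η

/-- The admissible controls `{η ∈ L²(Ω) : a ≤ η ≤ b a.e. in Ω}`; the bounds may be infinite. -/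
def Uad {n : ℕ} (Ω : Set (E n)) (a b : EReal) : Set (L2 Ω) :=
  {η | ∀ᵐ x ∂(vol Ω), a ≤ ((η x : ℝ) : EReal) ∧ ((η x : ℝ) : EReal) ≤ b}

/-- The bounds are real numbers `a < b`, or there is no constraint: `b = -a = ∞`. -/
def AdmissibleBounds (a b : EReal) : Prop :=
  (∃ r s : ℝ, r < s ∧ a = (r : EReal) ∧ b = (s : EReal)) ∨ (a = ⊥ ∧ b = ⊤)

/-- `u ∈ U_ad` minimises the reduced objective over `U_ad`. -/
def IsOptimalControl {n : ℕ} {Ω Γ : Set (E n)} (A : Fin n → Fin n → E n → ℝ) (a₀ : E n → ℝ)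
    (g : L2surf Γ) (ν : ℝ) (a b : EReal) (u : L2 Ω) : Prop :=
  u ∈ Uad Ω a b ∧
    ∀ η ∈ Uad Ω a b, reducedObjective A a₀ g ν u ≤ reducedObjective A a₀ g ν η

end SurfaceControl

/-!
Regularity of the optimal control comes from the optimality condition. The control-to-state operator
is `S = L ∘ ι*`, where `ι : H_0^1(Ω) → L²(Ω)` is the embedding and `L` the inverse supplied by the
Lax–Milgram theorem (`IsElliptic.exists_controlToState_eq`); coercivity on `H_0^1(Ω)` is ellipticity
together with the Poincaré inequality (`exists_poincare`). With the trace `T`, the derivative of the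
misfit term at `u` is `S* T* (T S u - g) = ι p`, where `p = L* T* (T S u - g)` is the adjoint state.
Hence it is the `L²` function of an element `p` of `H_0^1(Ω)`, and
`(p + ν u, η - u) ≥ 0` for all admissible `η` (`IsOptimalControl.exists_adjoint_state`). Of the trace
only its being a continuous linear operator on `H_0^1(Ω)` enters: that is what makes the functional
`v ↦ (T S u - g, T v)` an admissible right-hand side of the adjoint equation.

Therefore `u` is the pointwise projection of `-p / ν` onto the interval of admissible values
(`ae_eq_clamp_of_variational_inequality`), or `-p / ν` itself without bounds. The projection is
1-Lipschitz, and `H_0^1(Ω)` is stable under composition with 1-Lipschitz functions that vanish at `0`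
(`memH10_compLp`). In general the projection differs from such a function by a constant, which lies
in `H¹(Ω)`; the constant is `0` when the value `0` is within the bounds.

For the stability, mollify the Lipschitz function and compose with test functions: the chain rule
bounds the `H¹` norms, the compositions are again test functions and converge in `L²(Ω)`. The limit
stays in `H_0^1(Ω)` because the image of a ball of `H_0^1(Ω)` in `L²(Ω)` is closed, by weak
compactness (`isClosed_image_closedBall`).
-/

namespace SurfaceControl

variable {n : ℕ} {Ω : Set (E n)}

/-! ### Sobolev spaces and test functions -/

-- Shortcut instances: without them, instance search for the Hilbert space structure fails on
-- `H10 Ω`, a subspace of the subspace `H1 Ω`.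
noncomputable instance : NormedAddCommGroup (H1 Ω) := Submodule.normedAddCommGroup (H1 Ω)

noncomputable instance : InnerProductSpace ℝ (H1 Ω) := Submodule.innerProductSpace (H1 Ω)

noncomputable instance : SeminormedAddCommGroup (H1 Ω) :=
  NormedAddCommGroup.toSeminormedAddCommGroup

noncomputable instance : NormedSpace ℝ (H1 Ω) := InnerProductSpace.toNormedSpace

noncomputable instance : NormedAddCommGroup (H10 Ω) := Submodule.normedAddCommGroup (H10 Ω)

noncomputable instance : InnerProductSpace ℝ (H10 Ω) := Submodule.innerProductSpace (H10 Ω)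

noncomputable instance : SeminormedAddCommGroup (H10 Ω) :=
  NormedAddCommGroup.toSeminormedAddCommGroup

noncomputable instance : NormedSpace ℝ (H10 Ω) := InnerProductSpace.toNormedSpace

/-- The embedding `H¹(Ω) → L²(Ω)` as a continuous linear map. -/
noncomputable def toL2CLM (Ω : Set (E n)) : H1 Ω →L[ℝ] L2 Ω :=
  (WithLp.fstL 2 ℝ (L2 Ω) (PiLp 2 (fun _ : Fin n => L2 Ω))).comp (H1 Ω).subtypeL

/-- The weak partial derivative `H¹(Ω) → L²(Ω)` as a continuous linear map. -/
noncomputable def weakDerivCLM (Ω : Set (E n)) (i : Fin n) : H1 Ω →L[ℝ] L2 Ω :=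
  ((PiLp.proj 2 (fun _ : Fin n => L2 Ω) i : PiLp 2 (fun _ : Fin n => L2 Ω) →L[ℝ] L2 Ω).comp
    (WithLp.sndL 2 ℝ (L2 Ω) (PiLp 2 (fun _ : Fin n => L2 Ω)))).comp (H1 Ω).subtypeL

/-- The embedding `H_0^1(Ω) → L²(Ω)`. -/
noncomputable def embed (Ω : Set (E n)) : H10 Ω →L[ℝ] L2 Ω := (toL2CLM Ω).comp (H10 Ω).subtypeL

@[simp] theorem embed_apply (y : H10 Ω) : embed Ω y = toL2 (y : H1 Ω) := rfl

@[simp] theorem weakDerivCLM_apply (i : Fin n) (y : H1 Ω) :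
    weakDerivCLM Ω i y = weakDeriv y i := rfl

theorem H1.norm_sq (y : H1 Ω) : ‖y‖ ^ 2 = ‖toL2 y‖ ^ 2 + ∑ i, ‖weakDeriv y i‖ ^ 2 := by
  change ‖(y : Pair Ω)‖ ^ 2 = _
  rw [WithLp.prod_norm_sq_eq_of_L2, PiLp.norm_sq_eq_of_L2]
  rfl

theorem inner_L2_eq (f g : L2 Ω) : ⟪f, g⟫ = ∫ x in Ω, f x * g x := by
  rw [L2.inner_def]
  refine integral_congr_ae (.of_forall fun x => ?_)
  simp [mul_comm]

theorem inner_toLp_right (f : L2 Ω) {ψ : E n → ℝ} (hψ : MemLp ψ 2 (vol Ω)) :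
    ⟪f, hψ.toLp ψ⟫ = ∫ x in Ω, f x * ψ x := by
  rw [inner_L2_eq]
  refine integral_congr_ae ?_
  filter_upwards [hψ.coeFn_toLp] with x hx
  rw [hx]

namespace IsTest

variable {φ : E n → ℝ}

theorem memLp (hφ : IsTest Ω φ) : MemLp φ 2 (vol Ω) :=
  (hφ.smooth.continuous.memLp_of_hasCompactSupport hφ.compact).restrict Ω

theorem contDiff_partialDeriv (hφ : IsTest Ω φ) (i : Fin n) :
    ContDiff ℝ ∞ (partialDeriv i φ) :=
  (hφ.smooth.fderiv_right (m := ∞) (by simp)).clm_apply contDiff_const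

theorem hasCompactSupport_partialDeriv (hφ : IsTest Ω φ) (i : Fin n) :
    HasCompactSupport (partialDeriv i φ) :=
  hφ.compact.fderiv_apply (𝕜 := ℝ) _

theorem tsupport_partialDeriv_subset (i : Fin n) : tsupport (partialDeriv i φ) ⊆ tsupport φ :=
  tsupport_fderiv_apply_subset ℝ _

theorem memLp_partialDeriv (hφ : IsTest Ω φ) (i : Fin n) :
    MemLp (partialDeriv i φ) 2 (vol Ω) :=
  ((hφ.contDiff_partialDeriv i).continuous.memLp_of_hasCompactSupport
    (hφ.hasCompactSupport_partialDeriv i)).restrict Ω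

theorem eq_zero_of_notMem (hφ : IsTest Ω φ) {x : E n} (hx : x ∉ Ω) : φ x = 0 :=
  image_eq_zero_of_notMem_tsupport fun h => hx (hφ.support h)

theorem partialDeriv_eq_zero_of_notMem (hφ : IsTest Ω φ) (i : Fin n) {x : E n} (hx : x ∉ Ω) :
    partialDeriv i φ x = 0 :=
  image_eq_zero_of_notMem_tsupport fun h => hx (hφ.support (tsupport_partialDeriv_subset i h))

/-- Integration by parts for two smooth functions, one of them a test function. -/
theorem integral_mul_partialDeriv {ψ : E n → ℝ} (hφ : IsTest Ω φ) (hψ : ContDiff ℝ ∞ ψ)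
    (i : Fin n) :
    ∫ x in Ω, ψ x * partialDeriv i φ x = - ∫ x in Ω, partialDeriv i ψ x * φ x := by
  have hψ' : Continuous (partialDeriv i ψ) :=
    (hψ.continuous_fderiv (by simp)).clm_apply continuous_const
  rw [setIntegral_eq_integral_of_forall_compl_eq_zero
      (fun x hx => by rw [hφ.partialDeriv_eq_zero_of_notMem i hx, mul_zero]),
    setIntegral_eq_integral_of_forall_compl_eq_zero
      (fun x hx => by rw [hφ.eq_zero_of_notMem hx, mul_zero])]
  refine integral_mul_fderiv_eq_neg_fderiv_mul_of_integrable ?_ ?_ ?_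
    (fun x _ => (hψ.differentiable (by simp)) x) (fun x _ => (hφ.smooth.differentiable (by simp)) x)
  · exact (hψ'.mul hφ.smooth.continuous).integrable_of_hasCompactSupport hφ.compact.mul_left
  · exact (hψ.continuous.mul
      (hφ.contDiff_partialDeriv i).continuous).integrable_of_hasCompactSupport
        (hφ.hasCompactSupport_partialDeriv i).mul_left
  · exact (hψ.continuous.mul hφ.smooth.continuous).integrable_of_hasCompactSupport
      hφ.compact.mul_left

/-- The classical partial derivative of a test function is its weak derivative. -/
theorem isWeakDeriv (hφ : IsTest Ω φ) (i : Fin n) :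
    IsWeakDeriv Ω i (hφ.memLp.toLp φ) ((hφ.memLp_partialDeriv i).toLp _) := by
  intro χ hχ
  calc ∫ x in Ω, hφ.memLp.toLp φ x * partialDeriv i χ x
      = ∫ x in Ω, φ x * partialDeriv i χ x :=
        integral_congr_ae (hφ.memLp.coeFn_toLp.mono fun x hx => by simp only [hx])
    _ = - ∫ x in Ω, partialDeriv i φ x * χ x := hχ.integral_mul_partialDeriv hφ.smooth i
    _ = _ := congrArg Neg.neg (integral_congr_ae
        ((hφ.memLp_partialDeriv i).coeFn_toLp.mono fun x hx => by simp only [hx]))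

/-- A test function as an element of `H¹(Ω)`, with its classical gradient. -/
noncomputable def toH1 (hφ : IsTest Ω φ) : H1 Ω :=
  ⟨WithLp.toLp 2 (hφ.memLp.toLp φ, WithLp.toLp 2 fun i => (hφ.memLp_partialDeriv i).toLp _),
    fun i => hφ.isWeakDeriv i⟩

theorem toL2_toH1 (hφ : IsTest Ω φ) : toL2 hφ.toH1 = hφ.memLp.toLp φ := rfl

theorem weakDeriv_toH1 (hφ : IsTest Ω φ) (i : Fin n) :
    weakDeriv hφ.toH1 i = (hφ.memLp_partialDeriv i).toLp _ := rfl

theorem toH1_mem_H10 (hφ : IsTest Ω φ) : hφ.toH1 ∈ H10 Ω :=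
  (testSubmodule Ω).le_topologicalClosure ⟨φ, hφ, hφ.memLp.coeFn_toLp⟩

end IsTest

theorem isWeakDeriv_iff_inner {i : Fin n} {f g : L2 Ω} :
    IsWeakDeriv Ω i f g ↔ ∀ (φ : E n → ℝ) (hφ : IsTest Ω φ),
      ⟪f, (hφ.memLp_partialDeriv i).toLp _⟫ = - ⟪g, hφ.memLp.toLp φ⟫ := by
  simp only [IsWeakDeriv, inner_toLp_right]

/-- Weak derivatives on an open set are unique. -/
theorem IsWeakDeriv.unique (hΩ : IsOpen Ω) {i : Fin n} {f g g' : L2 Ω}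
    (h : IsWeakDeriv Ω i f g) (h' : IsWeakDeriv Ω i f g') : g = g' := by
  have hint : LocallyIntegrableOn (g - g' : L2 Ω) Ω (vol Ω) :=
    ((Lp.memLp (g - g')).locallyIntegrable (by norm_num)).locallyIntegrableOn Ω
  have key := hΩ.ae_eq_zero_of_integral_contDiff_smul_eq_zero hint fun φ h1 h2 h3 => by
    have hφ : IsTest Ω φ := ⟨h1, h2, h3⟩
    have e : ∫ x in Ω, (g - g' : L2 Ω) x * φ x = 0 := by
      rw [← inner_toLp_right _ hφ.memLp, inner_sub_left]
      have := isWeakDeriv_iff_inner.1 h φ hφ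
      have := isWeakDeriv_iff_inner.1 h' φ hφ
      linarith
    simpa [mul_comm] using e
  refine sub_eq_zero.1 (Lp.ext ?_)
  filter_upwards [key, ae_restrict_mem hΩ.measurableSet, Lp.coeFn_zero ℝ 2 (vol Ω)] with x h1 h2 h3
  rw [h1 h2, h3, Pi.zero_apply]

theorem H1.ext (hΩ : IsOpen Ω) {y z : H1 Ω} (h : toL2 y = toL2 z) : y = z := by
  refine Subtype.ext (WithLp.ofLp_injective 2 (Prod.ext h (WithLp.ofLp_injective 2 ?_)))
  funext i
  exact (show IsWeakDeriv Ω i (toL2 y) _ from y.2 i).unique hΩ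
    (show IsWeakDeriv Ω i (toL2 y) _ from h ▸ z.2 i)

theorem exists_toH1_of_mem_testSubmodule (hΩ : IsOpen Ω) {y : H1 Ω} (hy : y ∈ testSubmodule Ω) :
    ∃ (φ : E n → ℝ) (hφ : IsTest Ω φ), y = hφ.toH1 := by
  obtain ⟨φ, hφ, h⟩ := hy
  exact ⟨φ, hφ, H1.ext hΩ (Lp.ext (h.trans hφ.memLp.coeFn_toLp.symm))⟩

/-- A closed property of `H¹(Ω)` functions that holds for test functions holds on `H_0^1(Ω)`. -/
theorem H10.induction (hΩ : IsOpen Ω) {P : H1 Ω → Prop} (hP : IsClosed {y | P y})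
    (h : ∀ (φ : E n → ℝ) (hφ : IsTest Ω φ), P hφ.toH1) {y : H1 Ω} (hy : y ∈ H10 Ω) : P y := by
  refine closure_minimal (t := {y | P y}) ?_ hP hy
  intro z hz
  obtain ⟨φ, hφ, rfl⟩ := exists_toH1_of_mem_testSubmodule hΩ hz
  exact h φ hφ

theorem isClosed_H1 (Ω : Set (E n)) : IsClosed (H1 Ω : Set (Pair Ω)) := by
  have e : (H1 Ω : Set (Pair Ω)) = ⋂ (i : Fin n) (φ : E n → ℝ) (hφ : IsTest Ω φ),
      {p : Pair Ω | ⟪p.fst, (hφ.memLp_partialDeriv i).toLp _⟫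
        = - ⟪p.snd i, hφ.memLp.toLp φ⟫} := by
    ext p
    simp only [mem_iInter, mem_ofPred_eq]
    exact forall_congr' fun i => isWeakDeriv_iff_inner
  rw [e]
  refine isClosed_iInter fun i => isClosed_iInter fun φ => isClosed_iInter fun hφ => ?_
  have h1 : Continuous fun p : Pair Ω => p.fst :=
    (WithLp.fstL 2 ℝ (L2 Ω) (PiLp 2 (fun _ : Fin n => L2 Ω))).continuous
  have h2 : Continuous fun p : Pair Ω => p.snd i :=
    ((PiLp.proj 2 (fun _ : Fin n => L2 Ω) i : PiLp 2 (fun _ : Fin n => L2 Ω) →L[ℝ] L2 Ω).comp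
      (WithLp.sndL 2 ℝ (L2 Ω) (PiLp 2 (fun _ : Fin n => L2 Ω)))).continuous
  exact isClosed_eq (h1.inner continuous_const) (h2.inner continuous_const).neg

instance : CompleteSpace (H1 Ω) := (isClosed_H1 Ω).completeSpace_coe

instance : CompleteSpace (H10 Ω) :=
  (testSubmodule Ω).isClosed_topologicalClosure.completeSpace_coe

theorem memH1_of_ae_eq_const {f : L2 Ω} (c : ℝ)
    (hf : f =ᵐ[vol Ω] fun _ => c) : MemH1 f := by
  refine ⟨⟨WithLp.toLp 2 (f, 0), fun i φ hφ => ?_⟩, rfl⟩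
  have h1 : ∫ x in Ω, f x * partialDeriv i φ x = ∫ x in Ω, c * partialDeriv i φ x :=
    integral_congr_ae (hf.mono fun x hx => by simp only [hx])
  have h2 : ∫ x in Ω, (0 : L2 Ω) x * φ x = 0 := by
    rw [← inner_toLp_right _ hφ.memLp, inner_zero_left]
  have h3 := hφ.integral_mul_partialDeriv (contDiff_const (c := c)) i
  change ∫ x in Ω, f x * partialDeriv i φ x = - ∫ x in Ω, (0 : L2 Ω) x * φ x
  rw [h1, h2, h3]
  simp [partialDeriv]

/-! ### The Poincaré inequality -/

theorem partialDeriv_coord_mul {φ : E n → ℝ} (hφ : Differentiable ℝ φ) (i : Fin n) (x : E n) :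
    partialDeriv i (fun x => x i * φ x) x = φ x + x i * partialDeriv i φ x := by
  have h : HasFDerivAt (fun x : E n => x i) (EuclideanSpace.proj i : E n →L[ℝ] ℝ) x :=
    (EuclideanSpace.proj i : E n →L[ℝ] ℝ).hasFDerivAt
  have h2 : HasFDerivAt (fun x : E n => x i * φ x) _ x := h.mul (hφ x).hasFDerivAt
  rw [partialDeriv, h2.fderiv]
  simp [partialDeriv]
  ring

/-- The Poincaré inequality for test functions. It comes from testing the weak derivative of `φ`
with `x_i φ`, which gives `‖φ‖² = - 2 ∫ x_i φ ∂_i φ`. -/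
theorem IsTest.norm_le {φ : E n → ℝ} (hφ : IsTest Ω φ) {R : ℝ} (hΩm : MeasurableSet Ω)
    (hR : ∀ x ∈ Ω, ‖x‖ ≤ R) (hR0 : 0 ≤ R) (i : Fin n) :
    ‖toL2 hφ.toH1‖ ≤ 2 * R * ‖weakDeriv hφ.toH1 i‖ := by
  have hsm : ContDiff ℝ ∞ fun x : E n => x i :=
    (EuclideanSpace.proj i : E n →L[ℝ] ℝ).contDiff
  have hχ : IsTest Ω (fun x => x i * φ x) :=
    ⟨hsm.mul hφ.smooth, hφ.compact.mul_left,
      (closure_mono (Function.support_mul_subset_right _ _)).trans hφ.support⟩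
  have hle : ‖hχ.memLp.toLp _‖ ≤ R * ‖hφ.memLp.toLp φ‖ := by
    refine Lp.norm_le_mul_norm_of_ae_le_mul ?_
    filter_upwards [hχ.memLp.coeFn_toLp, hφ.memLp.coeFn_toLp, ae_restrict_mem hΩm] with x h1 h2 h3
    rw [h1, h2, norm_mul]
    exact mul_le_mul_of_nonneg_right ((PiLp.norm_apply_le x i).trans (hR x h3)) (norm_nonneg _)
  have key := hχ.integral_mul_partialDeriv hφ.smooth i
  set d := (hφ.memLp_partialDeriv i).toLp _ with hd
  set f := hφ.memLp.toLp φ with hf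
  set χ := hχ.memLp.toLp _ with hχd
  have e1 : ∫ x in Ω, partialDeriv i φ x * (x i * φ x) = ⟪d, χ⟫ := by
    rw [inner_toLp_right]
    refine integral_congr_ae ?_
    filter_upwards [(hφ.memLp_partialDeriv i).coeFn_toLp] with x hx
    rw [hd, hx]
  have e2 : ∫ x in Ω, φ x * partialDeriv i (fun x => x i * φ x) x = ⟪f, f⟫ + ⟪d, χ⟫ := by
    rw [inner_L2_eq, inner_L2_eq, ← integral_add]
    · refine integral_congr_ae ?_
      filter_upwards [(hφ.memLp_partialDeriv i).coeFn_toLp, hχ.memLp.coeFn_toLp,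
        hφ.memLp.coeFn_toLp] with x h1 h2 h3
      simp only [hd, hf, hχd, h1, h2, h3]
      rw [partialDeriv_coord_mul (hφ.smooth.differentiable (by simp))]
      ring
    · exact MemLp.integrable_mul (p := 2) (q := 2) (Lp.memLp f) (Lp.memLp f)
    · exact MemLp.integrable_mul (p := 2) (q := 2) (Lp.memLp d) (Lp.memLp χ)
  rw [e1, e2, real_inner_self_eq_norm_sq] at key
  have hcs := abs_le.1 ((abs_real_inner_le_norm d χ).trans
    (mul_le_mul_of_nonneg_left hle (norm_nonneg d)))
  change ‖f‖ ≤ 2 * R * ‖d‖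
  rcases (norm_nonneg f).eq_or_lt with h0 | h0
  · rw [← h0]; positivity
  · refine le_of_mul_le_mul_right ?_ h0
    nlinarith [hcs.1]

/-- The Poincaré inequality on `H_0^1(Ω)` for bounded `Ω`. -/
theorem exists_poincare (hΩ : IsOpen Ω) (hΩb : Bornology.IsBounded Ω) :
    ∃ C : ℝ, ∀ y ∈ H10 Ω, ∀ i, ‖toL2 y‖ ≤ C * ‖weakDeriv y i‖ := by
  obtain ⟨R, hR0, hR⟩ := hΩb.exists_pos_norm_le
  refine ⟨2 * R, fun y hy i => ?_⟩
  refine H10.induction (P := fun y => ‖toL2 y‖ ≤ 2 * R * ‖weakDeriv y i‖) hΩ ?_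
    (fun φ hφ => hφ.norm_le hΩ.measurableSet hR hR0.le i) hy
  exact isClosed_le (toL2CLM Ω).continuous.norm
    (continuous_const.mul (weakDerivCLM Ω i).continuous.norm)

/-! ### Composition with Lipschitz functions -/

/-- Weak compactness of balls of a Hilbert space: a continuous linear map between Hilbert spaces
maps closed balls to closed sets. -/
theorem isClosed_image_closedBall {H X : Type*} [NormedAddCommGroup H] [InnerProductSpace ℝ H]
    [CompleteSpace H] [NormedAddCommGroup X] [InnerProductSpace ℝ X] [CompleteSpace X]
    (T : H →L[ℝ] X) (C : ℝ) : IsClosed (T '' Metric.closedBall 0 C) := by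
  refine isClosed_iff_ultrafilter.2 fun x 𝒰 hx hmem => ?_
  -- Lift the ultrafilter to the ball and regard it as an ultrafilter on the dual space.
  obtain ⟨𝒱, h𝒱, hball⟩ : ∃ 𝒱 : Ultrafilter H, 𝒱.map T = 𝒰 ∧ Metric.closedBall 0 C ∈ 𝒱 := by
    have hne : (Filter.comap T 𝒰 ⊓ Filter.principal (Metric.closedBall 0 C)).NeBot := by
      rw [Filter.inf_principal_neBot_iff]
      rintro s ⟨t, ht, hts⟩
      obtain ⟨_, h1, y, hy, rfl⟩ := 𝒰.nonempty_of_mem (Filter.inter_mem ht hmem)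
      exact ⟨y, hts h1, hy⟩
    obtain ⟨𝒱, h⟩ := Ultrafilter.exists_le _ (h := hne)
    refine ⟨𝒱, Ultrafilter.coe_le_coe.1 ?_, Filter.le_principal_iff.1 (h.trans inf_le_right)⟩
    exact Filter.map_le_iff_le_comap.2 (h.trans inf_le_left)
  let D : H → WeakDual ℝ H := fun y => StrongDual.toWeakDual (InnerProductSpace.toDual ℝ H y)
  obtain ⟨ℓ, hℓ, hlim⟩ := (WeakDual.isCompact_closedBall (𝕜 := ℝ) (E := H) 0 C).ultrafilter_le_nhds
    (𝒱.map D) (Filter.le_principal_iff.2 (Filter.mem_map.2 (Filter.mem_of_superset hball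
      fun y hy => by simpa [D] using hy)))
  refine ⟨(InnerProductSpace.toDual ℝ H).symm (WeakDual.toStrongDual ℓ), by simpa using hℓ, ?_⟩
  refine ext_inner_right ℝ fun z => ?_
  rw [← ContinuousLinearMap.adjoint_inner_right, InnerProductSpace.toDual_symm_apply]
  have h1 : Filter.Tendsto (fun y => D y (ContinuousLinearMap.adjoint T z)) 𝒱
      (nhds (ℓ (ContinuousLinearMap.adjoint T z))) :=
    (WeakDual.eval_continuous _).tendsto ℓ |>.comp (show Filter.Tendsto D 𝒱 (nhds ℓ) from hlim)
  have h2 : Filter.Tendsto (fun y => ⟪T y, z⟫) 𝒱 (nhds ⟪x, z⟫) := by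
    have : Filter.Tendsto T 𝒱 (nhds x) := by
      rw [← h𝒱] at hx; exact hx
    exact this.inner tendsto_const_nhds
  refine tendsto_nhds_unique (h1.congr fun y => ?_) h2
  rw [← ContinuousLinearMap.adjoint_inner_right]
  rfl

/-- A 1-Lipschitz function vanishing at `0` is a uniform limit of smooth functions with the same
properties. -/
theorem exists_smooth_lipschitz_approx {G : ℝ → ℝ} (hG : LipschitzWith 1 G) (hG0 : G 0 = 0)
    {ε : ℝ} (hε : 0 < ε) :
    ∃ F : ℝ → ℝ, ContDiff ℝ ∞ F ∧ LipschitzWith 1 F ∧ F 0 = 0 ∧ ∀ t, |F t - G t| ≤ ε := by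
  let φ : ContDiffBump (0 : ℝ) := ⟨ε / 4, ε / 2, by positivity, by linarith⟩
  let M : ℝ → ℝ :=
    convolution (φ.normed volume) G (ContinuousLinearMap.lsmul ℝ ℝ) volume
  have hM : ContDiff ℝ ∞ M :=
    HasCompactSupport.contDiff_convolution_left _ φ.hasCompactSupport_normed
      φ.contDiff_normed hG.continuous.locallyIntegrable
  have hdist : ∀ t, |M t - G t| ≤ ε / 2 := fun t => by
    rw [← Real.dist_eq]
    refine φ.dist_normed_convolution_le hG.continuous.aestronglyMeasurable fun x hx => ?_
    have h1 := hG.dist_le_mul x t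
    have h2 : dist x t < ε / 2 := hx
    simp only [NNReal.coe_one, one_mul] at h1
    linarith
  have hint : ∀ t, Integrable (fun s => φ.normed volume s * G (t - s)) := fun t =>
    (φ.continuous_normed.mul (hG.continuous.comp
      (continuous_const.sub continuous_id))).integrable_of_hasCompactSupport
        φ.hasCompactSupport_normed.mul_right
  have hLip : LipschitzWith 1 M := by
    refine LipschitzWith.of_dist_le_mul fun s t => ?_
    have e : M s - M t = ∫ r, φ.normed volume r * (G (s - r) - G (t - r)) := by
      simp only [M, convolution, ContinuousLinearMap.lsmul_apply, smul_eq_mul]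
      rw [← integral_sub (hint s) (hint t)]
      simp only [mul_sub]
    rw [Real.dist_eq, e, ← Real.norm_eq_abs]
    calc ‖∫ r, φ.normed volume r * (G (s - r) - G (t - r))‖
        ≤ ∫ r, φ.normed volume r * dist s t := by
          refine norm_integral_le_of_norm_le (φ.integrable_normed.mul_const _)
            (.of_forall fun r => ?_)
          rw [norm_mul, Real.norm_of_nonneg (φ.nonneg_normed r)]
          refine mul_le_mul_of_nonneg_left ?_ (φ.nonneg_normed r)
          have := hG.dist_le_mul (s - r) (t - r)
          simpa [Real.dist_eq] using this
      _ = (1 : NNReal) * dist s t := by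
          rw [integral_mul_const, φ.integral_normed, NNReal.coe_one]
  refine ⟨fun t => M t - M 0, hM.sub contDiff_const, ?_, sub_self _, fun t => ?_⟩
  · simpa using hLip.sub (LipschitzWith.const (M 0))
  · have h1 := abs_le.1 (hdist t)
    have h2 := abs_le.1 (hdist 0)
    rw [hG0] at h2
    exact abs_le.2 ⟨by linarith [h1.1, h2.2], by linarith [h1.2, h2.1]⟩

theorem IsTest.comp {φ : E n → ℝ} (hφ : IsTest Ω φ) {F : ℝ → ℝ} (hF : ContDiff ℝ ∞ F)
    (hF0 : F 0 = 0) : IsTest Ω (F ∘ φ) :=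
  ⟨hF.comp hφ.smooth, hφ.compact.comp_left hF0,
    (closure_mono (Function.support_comp_subset hF0 φ)).trans hφ.support⟩

/-- Composition with a smooth 1-Lipschitz function vanishing at `0` does not increase the `H¹`
norm, by the chain rule. -/
theorem IsTest.norm_toH1_comp_le {φ : E n → ℝ} (hφ : IsTest Ω φ) {F : ℝ → ℝ}
    (hF : ContDiff ℝ ∞ F) (hF0 : F 0 = 0) (hL : LipschitzWith 1 F) :
    ‖(hφ.comp hF hF0).toH1‖ ≤ ‖hφ.toH1‖ := by
  refine le_of_sq_le_sq ?_ (norm_nonneg _)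
  rw [H1.norm_sq, H1.norm_sq]
  refine add_le_add (pow_le_pow_left₀ (norm_nonneg _) ?_ 2)
    (Finset.sum_le_sum fun i _ => pow_le_pow_left₀ (norm_nonneg _) ?_ 2)
  · refine Lp.norm_le_norm_of_ae_le ?_
    filter_upwards [(hφ.comp hF hF0).memLp.coeFn_toLp, hφ.memLp.coeFn_toLp] with x h1 h2
    rw [IsTest.toL2_toH1, IsTest.toL2_toH1, h1, h2]
    simpa [hF0] using hL.norm_sub_le (φ x) 0
  · refine Lp.norm_le_norm_of_ae_le ?_
    filter_upwards [((hφ.comp hF hF0).memLp_partialDeriv i).coeFn_toLp,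
      (hφ.memLp_partialDeriv i).coeFn_toLp] with x h1 h2
    rw [IsTest.weakDeriv_toH1, IsTest.weakDeriv_toH1, h1, h2, partialDeriv,
      ((hF.differentiable (by simp) (φ x)).hasDerivAt.comp_hasFDerivAt x
        (hφ.smooth.differentiable (by simp) x).hasFDerivAt).fderiv,
      smul_apply, norm_smul]
    exact mul_le_of_le_one_left (norm_nonneg _) (norm_deriv_le_of_lipschitz hL)

/-- For a test function `φ`, the composition `G ∘ φ` is the `L²` limit of the test functions `F ∘ φ`
with `F` a smooth approximation of `G`, all of `H¹` norm at most `‖φ‖`. -/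
theorem compLp_mem_image_closedBall {φ : E n → ℝ} (hφ : IsTest Ω φ) (hΩb : Bornology.IsBounded Ω)
    {G : ℝ → ℝ} (hG : LipschitzWith 1 G) (hG0 : G 0 = 0) :
    hG.compLp hG0 (toL2 hφ.toH1) ∈
      embed Ω '' Metric.closedBall 0 ‖hφ.toH1‖ := by
  have hfin : volume Ω ≠ ⊤ := hΩb.measure_lt_top.ne
  have : IsFiniteMeasure (vol Ω) := ⟨by simpa using hfin.lt_top⟩
  refine (isClosed_image_closedBall (H := H10 Ω) (X := L2 Ω) (embed Ω) ‖hφ.toH1‖).closure_subset ?_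
  set K := (measureUnivNNReal (vol Ω) : ℝ) ^ (2 : ENNReal).toReal⁻¹ with hK
  rw [Metric.mem_closure_iff]
  intro ε hε
  have hK0 : 0 ≤ K := by positivity
  obtain ⟨F, hF, hFL, hF0, hFG⟩ := exists_smooth_lipschitz_approx hG hG0
    (ε := ε / (2 * (K + 1))) (by positivity)
  refine ⟨_, ⟨⟨(hφ.comp hF hF0).toH1, (hφ.comp hF hF0).toH1_mem_H10⟩, ?_, rfl⟩, ?_⟩
  · rw [mem_closedBall_zero_iff]
    exact hφ.norm_toH1_comp_le hF hF0 hFL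
  · rw [dist_comm, dist_eq_norm]
    refine (Lp.norm_le_of_ae_bound (C := ε / (2 * (K + 1))) (by positivity) ?_).trans_lt ?_
    · filter_upwards [Lp.coeFn_sub (toL2 (hφ.comp hF hF0).toH1) (hG.compLp hG0 (toL2 hφ.toH1)),
        hG.coeFn_compLp hG0 (toL2 hφ.toH1), (hφ.comp hF hF0).memLp.coeFn_toLp,
        hφ.memLp.coeFn_toLp] with x h1 h2 h3 h4
      change ‖(toL2 (hφ.comp hF hF0).toH1 - hG.compLp hG0 (toL2 hφ.toH1) : L2 Ω) x‖ ≤ _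
      rw [h1, Pi.sub_apply, h2, IsTest.toL2_toH1, h3, Function.comp, Function.comp,
        IsTest.toL2_toH1, h4]
      exact hFG _
    · rw [← hK, mul_div_assoc', div_lt_iff₀ (by positivity)]
      nlinarith

/-- `H_0^1(Ω)` is stable under composition with 1-Lipschitz functions vanishing at `0`. -/
theorem memH10_compLp (hΩ : IsOpen Ω) (hΩb : Bornology.IsBounded Ω) {G : ℝ → ℝ}
    (hG : LipschitzWith 1 G) (hG0 : G 0 = 0) {y : H1 Ω} (hy : y ∈ H10 Ω) :
    MemH10 (hG.compLp hG0 (toL2 y)) := by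
  suffices h : hG.compLp hG0 (toL2 y) ∈
      embed Ω '' Metric.closedBall 0 (‖y‖ + 1) by
    obtain ⟨z, -, hz⟩ := h
    exact ⟨z, z.2, hz⟩
  refine (isClosed_image_closedBall (H := H10 Ω) (X := L2 Ω) (embed Ω) (‖y‖ + 1)).closure_subset ?_
  have hcont : Continuous fun z : H1 Ω => hG.compLp hG0 (toL2 z) :=
    (hG.continuous_compLp hG0).comp (toL2CLM Ω).continuous
  rw [mem_closure_iff_nhds]
  intro t ht
  obtain ⟨z, ⟨hz1, hz2⟩, hz⟩ := mem_closure_iff_nhds.1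
    (show y ∈ closure (testSubmodule Ω : Set (H1 Ω)) from hy) _
    (Filter.inter_mem (hcont.continuousAt.preimage_mem_nhds ht) (Metric.ball_mem_nhds y one_pos))
  obtain ⟨φ, hφ, rfl⟩ := exists_toH1_of_mem_testSubmodule hΩ hz
  refine ⟨_, hz1, ?_⟩
  refine image_mono (Metric.closedBall_subset_closedBall ?_)
    (compLp_mem_image_closedBall hφ hΩb hG hG0)
  have : ‖hφ.toH1 - y‖ < 1 := by rwa [← dist_eq_norm]
  linarith [norm_le_norm_add_norm_sub' hφ.toH1 y]

/-! ### Multiplication by bounded functions -/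

/-- Multiplication by an `L^∞` function as a continuous linear operator on `L²(Ω)`. -/
noncomputable def mulCLM {w : E n → ℝ} (hw : MemLp w ⊤ (vol Ω)) : L2 Ω →L[ℝ] L2 Ω :=
  (ContinuousLinearMap.mul ℝ ℝ).holderL (vol Ω) ⊤ 2 2 (hw.toLp w)

theorem coeFn_mulCLM {w : E n → ℝ} (hw : MemLp w ⊤ (vol Ω)) (f : L2 Ω) :
    mulCLM hw f =ᵐ[vol Ω] fun x => w x * f x := by
  have h : mulCLM hw f =ᵐ[vol Ω] _ :=
    (ContinuousLinearMap.mul ℝ ℝ).coeFn_holder (r := 2) (hw.toLp w) f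
  filter_upwards [h, hw.coeFn_toLp] with x h1 h2
  rw [h1, h2]
  rfl

theorem inner_mulCLM {w : E n → ℝ} (hw : MemLp w ⊤ (vol Ω)) (f g : L2 Ω) :
    ⟪mulCLM hw f, g⟫ = ∫ x in Ω, w x * f x * g x := by
  rw [inner_L2_eq]
  exact integral_congr_ae ((coeFn_mulCLM hw f).mono fun x hx => by simp only [hx])

theorem integrable_mul_mul {w : E n → ℝ} (hw : MemLp w ⊤ (vol Ω)) (f g : L2 Ω) :
    Integrable (fun x => w x * f x * g x) (vol Ω) :=
  (MemLp.integrable_mul (p := 2) (q := 2) (Lp.memLp (mulCLM hw f)) (Lp.memLp g)).congr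
    ((coeFn_mulCLM hw f).mono fun x hx => by simp only [Pi.mul_apply, hx])

theorem IsElliptic.memLp_top (hΩ : IsOpen Ω) (hΩb : Bornology.IsBounded Ω)
    {A : Fin n → Fin n → E n → ℝ} {a₀ : E n → ℝ} (hA : IsElliptic Ω A a₀) (i j : Fin n) :
    MemLp (A i j) ⊤ (vol Ω) := by
  obtain ⟨K, hK⟩ := hA.lipschitz i j
  obtain ⟨C, hC⟩ := hΩb.isCompact_closure.exists_bound_of_continuousOn hK.continuousOn
  refine memLp_top_of_bound
    ((hK.continuousOn.mono subset_closure).aestronglyMeasurable hΩ.measurableSet) C ?_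
  filter_upwards [ae_restrict_mem hΩ.measurableSet] with x hx
  exact hC x (subset_closure hx)

/-! ### The state equation -/

/-- The bilinear form `a(·,·)` on `H_0^1(Ω)` as a continuous bilinear map. -/
noncomputable def bilinCLM {A : Fin n → Fin n → E n → ℝ} {a₀ : E n → ℝ}
    (hA : ∀ i j, MemLp (A i j) ⊤ (vol Ω)) (ha : MemLp a₀ ⊤ (vol Ω)) :
    H10 Ω →L[ℝ] H10 Ω →L[ℝ] ℝ :=
  (∑ i, ∑ j, (innerSL ℝ : L2 Ω →L[ℝ] L2 Ω →L[ℝ] ℝ).bilinearComp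
      ((mulCLM (hA i j)).comp ((weakDerivCLM Ω i).comp (H10 Ω).subtypeL))
      ((weakDerivCLM Ω j).comp (H10 Ω).subtypeL)) +
    (innerSL ℝ : L2 Ω →L[ℝ] L2 Ω →L[ℝ] ℝ).bilinearComp ((mulCLM ha).comp (embed Ω)) (embed Ω)

theorem bilinCLM_apply {A : Fin n → Fin n → E n → ℝ} {a₀ : E n → ℝ}
    (hA : ∀ i j, MemLp (A i j) ⊤ (vol Ω)) (ha : MemLp a₀ ⊤ (vol Ω)) (z v : H10 Ω) :
    bilinCLM hA ha z v = bilin A a₀ (z : H1 Ω) (v : H1 Ω) := by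
  simp [bilinCLM, bilin, inner_mulCLM]

/-- On a bounded open set the form `a(·,·)` is coercive on `H_0^1(Ω)`, by ellipticity and the
Poincaré inequality. -/
theorem IsElliptic.isCoercive (hn : 0 < n) (hΩ : IsOpen Ω) (hΩb : Bornology.IsBounded Ω)
    {A : Fin n → Fin n → E n → ℝ} {a₀ : E n → ℝ} (hA : IsElliptic Ω A a₀) :
    IsCoercive (bilinCLM (hA.memLp_top hΩ hΩb) hA.bounded) := by
  obtain ⟨α, hα, hell⟩ := hA.elliptic
  obtain ⟨C, hC⟩ := exists_poincare hΩ hΩb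
  refine ⟨α / (C ^ 2 + 1), by positivity, fun y => ?_⟩
  have hAm := hA.memLp_top hΩ hΩb
  set d := fun i => weakDeriv (y : H1 Ω) i with hd
  have hzero : 0 ≤ ∫ x in Ω, a₀ x * toL2 (y : H1 Ω) x * toL2 (y : H1 Ω) x := by
    refine integral_nonneg_of_ae ?_
    filter_upwards [hA.nonneg] with x hx
    rw [Pi.zero_apply, mul_assoc]
    exact mul_nonneg hx (mul_self_nonneg _)
  have hgrad : α * ∑ i, ‖d i‖ ^ 2 ≤ ∑ i, ∑ j, ∫ x in Ω, A i j x * d i x * d j x := by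
    have e : α * ∑ i, ‖d i‖ ^ 2 = ∫ x in Ω, α * ∑ i, d i x * d i x := by
      rw [integral_const_mul, integral_finsetSum]
      · simp only [← inner_L2_eq, real_inner_self_eq_norm_sq]
      · exact fun i _ => MemLp.integrable_mul (p := 2) (q := 2) (Lp.memLp (d i)) (Lp.memLp (d i))
    have e' : ∑ i, ∑ j, ∫ x in Ω, A i j x * d i x * d j x
        = ∫ x in Ω, ∑ i, ∑ j, A i j x * d i x * d j x := by
      rw [integral_finsetSum]
      · refine Finset.sum_congr rfl fun i _ => ?_
        rw [integral_finsetSum]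
        exact fun j _ => integrable_mul_mul (hAm i j) (d i) (d j)
      · exact fun i _ => integrable_finsetSum _ fun j _ =>
          integrable_mul_mul (hAm i j) (d i) (d j)
    rw [e, e']
    refine integral_mono_ae ?_ ?_ ?_
    · exact (integrable_finsetSum _ fun i _ =>
        MemLp.integrable_mul (p := 2) (q := 2) (Lp.memLp (d i)) (Lp.memLp (d i))).const_mul α
    · exact integrable_finsetSum _ fun i _ => integrable_finsetSum _ fun j _ =>
        integrable_mul_mul (hAm i j) (d i) (d j)
    · filter_upwards [ae_restrict_mem hΩ.measurableSet] with x hx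
      have := hell x hx (WithLp.toLp 2 fun i => d i x)
      rw [EuclideanSpace.norm_sq_eq] at this
      simpa [sq] using this
  have hpoin : ‖toL2 (y : H1 Ω)‖ ^ 2 ≤ C ^ 2 * ∑ i, ‖d i‖ ^ 2 := by
    have h1 := pow_le_pow_left₀ (norm_nonneg _) (hC y y.2 ⟨0, hn⟩) 2
    rw [mul_pow] at h1
    exact h1.trans (mul_le_mul_of_nonneg_left
      (Finset.single_le_sum (f := fun i => ‖d i‖ ^ 2) (fun i _ => sq_nonneg _)
        (Finset.mem_univ _)) (sq_nonneg C))
  have hnorm : ‖y‖ ^ 2 = ‖toL2 (y : H1 Ω)‖ ^ 2 + ∑ i, ‖d i‖ ^ 2 := H1.norm_sq (y : H1 Ω)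
  rw [bilinCLM_apply, bilin, mul_assoc, ← sq, hnorm, div_mul_eq_mul_div,
    div_le_iff₀ (by positivity)]
  have h2 := mul_le_mul_of_nonneg_left hpoin hα.le
  have h3 := mul_le_mul_of_nonneg_right (add_le_add hgrad hzero)
    (show 0 ≤ C ^ 2 + 1 by positivity)
  linarith

/-- The Lax–Milgram theorem with right-hand sides from a space `X` into which `V` is mapped by `ι`:
the solution operator factors as `L ∘ ι*`. -/
theorem _root_.IsCoercive.exists_solution_operator {V X : Type*} [NormedAddCommGroup V]
    [InnerProductSpace ℝ V] [CompleteSpace V] [NormedAddCommGroup X] [InnerProductSpace ℝ X]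
    [CompleteSpace X] {B : V →L[ℝ] V →L[ℝ] ℝ} (hB : IsCoercive B) (ι : V →L[ℝ] X) :
    ∃ L : V →L[ℝ] V, ∀ (η : X) (y : V),
      (∀ v, B y v = ⟪η, ι v⟫) ↔ y = L (ContinuousLinearMap.adjoint ι η) := by
  refine ⟨hB.continuousLinearEquivOfBilin.symm, fun η y => ?_⟩
  rw [ContinuousLinearEquiv.coe_coe, ContinuousLinearEquiv.eq_symm_apply]
  simp only [← hB.continuousLinearEquivOfBilin_apply, ← ContinuousLinearMap.adjoint_inner_left]
  exact ⟨ext_inner_right ℝ, fun h v => by rw [h]⟩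

theorem IsElliptic.exists_controlToState_eq (hn : 0 < n) (hΩ : IsOpen Ω)
    (hΩb : Bornology.IsBounded Ω) {A : Fin n → Fin n → E n → ℝ} {a₀ : E n → ℝ}
    (hA : IsElliptic Ω A a₀) : ∃ L : H10 Ω →L[ℝ] H10 Ω, ∀ η : L2 Ω,
      controlToState A a₀ η = L (ContinuousLinearMap.adjoint (embed Ω) η) := by
  obtain ⟨L, hL⟩ := (hA.isCoercive hn hΩ hΩb).exists_solution_operator (embed Ω)
  have hiff : ∀ (η : L2 Ω) (y : H10 Ω), IsState A a₀ η y ↔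
      y = L (ContinuousLinearMap.adjoint (embed Ω) η) := fun η y => by
    rw [← hL]
    simp only [bilinCLM_apply, embed_apply, IsState]
  exact ⟨L, fun η =>
    (hiff η _).1 (Classical.epsilon_spec (p := IsState A a₀ η) ⟨_, (hiff η _).2 rfl⟩)⟩

/-! ### The optimality condition -/

/-- First-order necessary condition for a Tikhonov functional on a convex set. -/
theorem variational_inequality {X Y : Type*} [NormedAddCommGroup X] [InnerProductSpace ℝ X]
    [CompleteSpace X] [NormedAddCommGroup Y] [InnerProductSpace ℝ Y] [CompleteSpace Y]
    (K : X →L[ℝ] Y) (g : Y) {ν : ℝ} (hν : 0 ≤ ν) {s : Set X} (hs : Convex ℝ s) {u : X}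
    (hu : u ∈ s)
    (hmin : ∀ η ∈ s, 1 / 2 * ‖K u - g‖ ^ 2 + ν / 2 * ‖u‖ ^ 2
      ≤ 1 / 2 * ‖K η - g‖ ^ 2 + ν / 2 * ‖η‖ ^ 2) {η : X} (hη : η ∈ s) :
    0 ≤ ⟪ContinuousLinearMap.adjoint K (K u - g) + ν • u, η - u⟫ := by
  rw [inner_add_left, ContinuousLinearMap.adjoint_inner_left, real_inner_smul_left]
  set d := η - u
  set m := ⟪K u - g, K d⟫ + ν * ⟪u, d⟫
  set c := 1 / 2 * ‖K d‖ ^ 2 + ν / 2 * ‖d‖ ^ 2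
  have hc : 0 ≤ c := by positivity
  have key : ∀ t : ℝ, 0 < t → t ≤ 1 → 0 ≤ m + t * c := by
    intro t ht ht1
    have h := hmin _ (hs.add_smul_sub_mem hu hη ⟨ht.le, ht1⟩)
    have e : K (u + t • d) - g = (K u - g) + t • K d := by
      rw [map_add, map_smul]; abel
    change _ ≤ 1 / 2 * ‖K (u + t • d) - g‖ ^ 2 + ν / 2 * ‖u + t • d‖ ^ 2 at h
    rw [e, norm_add_sq_real, norm_add_sq_real u, real_inner_smul_right, real_inner_smul_right,
      norm_smul, norm_smul, mul_pow, mul_pow, Real.norm_eq_abs, sq_abs] at h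
    have : 0 ≤ t * (m + t * c) := by
      simp only [m, c]
      linarith
    exact nonneg_of_mul_nonneg_right this ht
  by_contra hneg
  push Not at hneg
  have hpos : 0 < -m / (2 * (c + 1)) := div_pos (by linarith) (by positivity)
  have h1 := key (min 1 (-m / (2 * (c + 1)))) (lt_min one_pos hpos) (min_le_left _ _)
  have h2 : min 1 (-m / (2 * (c + 1))) * c ≤ -m / (2 * (c + 1)) * (c + 1) :=
    mul_le_mul (min_le_right _ _) (by linarith) hc hpos.le
  have h3 : -m / (2 * (c + 1)) * (c + 1) = -m / 2 := by field_simp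
  linarith

/-- When the control-to-observation operator is `T ∘ L ∘ ι*`, the derivative of the misfit term is
`ι p` with `p = L* T* (T L ι* u - g)`, so it lies in the range of `ι`. -/
theorem exists_adjoint_of_isMinOn {V X Y : Type*} [NormedAddCommGroup V] [InnerProductSpace ℝ V]
    [CompleteSpace V] [NormedAddCommGroup X] [InnerProductSpace ℝ X] [CompleteSpace X]
    [NormedAddCommGroup Y] [InnerProductSpace ℝ Y] [CompleteSpace Y] (ι : V →L[ℝ] X)
    (L : V →L[ℝ] V) (T : V →L[ℝ] Y) (g : Y) {ν : ℝ} (hν : 0 ≤ ν) {s : Set X} (hs : Convex ℝ s)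
    {u : X} (hu : u ∈ s)
    (hmin : ∀ η ∈ s,
      1 / 2 * ‖T (L (ContinuousLinearMap.adjoint ι u)) - g‖ ^ 2 + ν / 2 * ‖u‖ ^ 2
        ≤ 1 / 2 * ‖T (L (ContinuousLinearMap.adjoint ι η)) - g‖ ^ 2 + ν / 2 * ‖η‖ ^ 2) :
    ∃ p : V, ∀ η ∈ s, 0 ≤ ⟪ι p + ν • u, η - u⟫ := by
  refine ⟨ContinuousLinearMap.adjoint L (ContinuousLinearMap.adjoint T
    (T (L (ContinuousLinearMap.adjoint ι u)) - g)), fun η hη => ?_⟩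
  have h := variational_inequality (T.comp (L.comp (ContinuousLinearMap.adjoint ι))) g hν hs hu
    hmin hη
  rwa [ContinuousLinearMap.adjoint_comp, ContinuousLinearMap.adjoint_comp,
    ContinuousLinearMap.adjoint_adjoint] at h

/-- The variational inequality for bound constraints is solved by the pointwise projection onto
the interval of admissible values. -/
theorem ae_eq_clamp_of_variational_inequality {r s : ℝ} (hrs : r ≤ s) {u q : L2 Ω}
    (hu : ∀ᵐ x ∂(vol Ω), r ≤ u x ∧ u x ≤ s)
    (hvar : ∀ η : L2 Ω, (∀ᵐ x ∂(vol Ω), r ≤ η x ∧ η x ≤ s) → 0 ≤ ⟪u - q, η - u⟫)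
    {c : L2 Ω} (hc : c =ᵐ[vol Ω] fun x => max r (min s (q x))) : u = c := by
  have h1 := hvar c (by
    filter_upwards [hc] with x hx
    rw [hx]
    exact ⟨le_max_left _ _, max_le hrs (min_le_left _ _)⟩)
  have h2 : 0 ≤ ⟪c - q, u - c⟫ := by
    rw [inner_L2_eq]
    refine integral_nonneg_of_ae ?_
    filter_upwards [hc, hu, Lp.coeFn_sub c q, Lp.coeFn_sub u c] with x h1 h2 h3 h4
    rw [h3, h4, Pi.sub_apply, Pi.sub_apply, h1, Pi.zero_apply]
    rcases le_total s (q x) with h | h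
    · rw [min_eq_left h, max_eq_right hrs]
      exact mul_nonneg_of_nonpos_of_nonpos (by linarith) (by linarith)
    · rw [min_eq_right h]
      rcases le_total r (q x) with h' | h'
      · rw [max_eq_right h']; simp
      · rw [max_eq_left h']
        exact mul_nonneg (by linarith) (by linarith)
  have h3 : ‖u - c‖ ^ 2 = -(⟪u - q, c - u⟫ + ⟪c - q, u - c⟫) := by
    rw [← real_inner_self_eq_norm_sq, ← neg_sub u c, inner_neg_right, ← sub_eq_neg_add, neg_sub,
      ← inner_sub_left]
    congr 1
    abel
  exact sub_eq_zero.1 (norm_eq_zero.1 (pow_eq_zero_iff (two_ne_zero) |>.1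
    (le_antisymm (by linarith) (sq_nonneg _))))

theorem mem_Uad_coe {r s : ℝ} {η : L2 Ω} :
    η ∈ Uad Ω (r : EReal) (s : EReal) ↔ ∀ᵐ x ∂(vol Ω), r ≤ η x ∧ η x ≤ s := by
  simp [Uad]

theorem convex_Uad {a b : EReal} (hab : AdmissibleBounds a b) : Convex ℝ (Uad Ω a b) := by
  rcases hab with ⟨r, s, -, rfl, rfl⟩ | ⟨rfl, rfl⟩
  · intro f hf g hg t t' ht ht' htt
    rw [mem_Uad_coe] at hf hg ⊢
    filter_upwards [hf, hg, Lp.coeFn_add (t • f) (t' • g), Lp.coeFn_smul t f,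
      Lp.coeFn_smul t' g] with x h1 h2 h3 h4 h5
    rw [h3, Pi.add_apply, h4, h5]
    exact (convex_Icc r s) h1 h2 ht ht' htt
  · have : Uad Ω (⊥ : EReal) ⊤ = univ := by simp [Uad]
    rw [this]
    exact convex_univ

/-- The optimality condition: there is `p ∈ H_0^1(Ω)`, the adjoint state, with
`(p + ν u, η - u) ≥ 0` for all admissible `η`. -/
theorem IsOptimalControl.exists_adjoint_state {Γ : Set (E n)} (hn : 0 < n) (hΩ : IsOpen Ω)
    (hΩb : Bornology.IsBounded Ω) {A : Fin n → Fin n → E n → ℝ} {a₀ : E n → ℝ}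
    (hA : IsElliptic Ω A a₀) {g : L2surf Γ} {ν : ℝ} (hν : 0 ≤ ν) {a b : EReal}
    (hab : AdmissibleBounds a b) {u : L2 Ω} (hu : IsOptimalControl A a₀ g ν a b u) :
    ∃ p : H10 Ω, ∀ η ∈ Uad Ω a b, 0 ≤ ⟪toL2 (p : H1 Ω) + ν • u, η - u⟫ := by
  obtain ⟨L, hL⟩ := hA.exists_controlToState_eq hn hΩ hΩb
  refine exists_adjoint_of_isMinOn (embed Ω) L (trace Ω Γ) g hν (convex_Uad hab) hu.1
    fun η hη => ?_
  have h := hu.2 η hη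
  rwa [reducedObjective, reducedObjective, objective, objective, hL, hL] at h

end SurfaceControl

open SurfaceControl in
theorem corollary3p3 (n : ℕ) (hn : n = 2 ∨ n = 3)
    (Ω : Set (SurfaceControl.E n)) (hΩ : IsOpen Ω) (hΩb : Bornology.IsBounded Ω)
    (A : Fin n → Fin n → SurfaceControl.E n → ℝ) (a₀ : SurfaceControl.E n → ℝ)
    (hA : SurfaceControl.IsElliptic Ω A a₀)
    (Γ : Set (SurfaceControl.E n)) (hΓ : SurfaceControl.IsAdmissibleSurface Ω Γ)
    (g : SurfaceControl.L2surf Γ) (ν : ℝ) (hν : 0 < ν)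
    (a b : EReal) (hab : SurfaceControl.AdmissibleBounds a b)
    (u : SurfaceControl.L2 Ω) (hu : SurfaceControl.IsOptimalControl A a₀ g ν a b u) :
    SurfaceControl.MemH1 u ∧ (a ≤ 0 → 0 ≤ b → SurfaceControl.MemH10 u) := by
  obtain ⟨p, hp⟩ := hu.exists_adjoint_state (by omega) hΩ hΩb hA hν.le hab
  -- With `q = -p / ν` the inequality reads `(u - q, η - u) ≥ 0`: `u` is the projection of `q`.
  set y : H10 Ω := -(ν⁻¹ • p)
  set q : L2 Ω := toL2 (y : H1 Ω)
  have hpq : toL2 (p : H1 Ω) + ν • u = ν • (u - q) := by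
    have : q = -(ν⁻¹ • toL2 (p : H1 Ω)) := rfl
    rw [this, sub_neg_eq_add, smul_add, smul_inv_smul₀ hν.ne', add_comm]
  have hvar : ∀ η ∈ Uad Ω a b, 0 ≤ ⟪u - q, η - u⟫ := fun η hη => by
    have := hp η hη
    rw [hpq, real_inner_smul_left] at this
    exact nonneg_of_mul_nonneg_right this hν
  rcases hab with ⟨r, s, hrs, rfl, rfl⟩ | ⟨rfl, rfl⟩
  · have hclamp : LipschitzWith 1 fun t : ℝ => max r (min s t) :=
      (LipschitzWith.id.const_min s).const_max r
    set k := max r (min s 0) with hk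
    -- The clamp need not vanish at `0`; its increment `G` does, so that `G ∘ y` lies in `H_0^1(Ω)`.
    set G : ℝ → ℝ := fun t => max r (min s t) - k with hGd
    have hG : LipschitzWith 1 G := by
      simpa using hclamp.sub (LipschitzWith.const k)
    have hG0 : G 0 = 0 := sub_self _
    obtain ⟨z, hz, hzq⟩ := memH10_compLp hΩ hΩb hG hG0 y.2
    have : IsFiniteMeasure (vol Ω) := ⟨by simpa using hΩb.measure_lt_top⟩
    have hconst : MemLp (fun _ : E n => k) 2 (vol Ω) := memLp_const k
    have hu_eq : u = toL2 z + hconst.toLp _ := by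
      refine ae_eq_clamp_of_variational_inequality hrs.le (mem_Uad_coe.1 hu.1)
        (fun η hη => hvar η (mem_Uad_coe.2 hη)) ?_
      filter_upwards [Lp.coeFn_add (toL2 z) (hconst.toLp _), hconst.coeFn_toLp,
        hG.coeFn_compLp hG0 q] with x h1 h2 h3
      rw [h1, Pi.add_apply, h2, hzq, h3]
      simp [hGd]
    constructor
    · obtain ⟨w, hw⟩ := memH1_of_ae_eq_const k hconst.coeFn_toLp
      exact ⟨z + w, by rw [hu_eq, ← hw]; rfl⟩
    · intro ha hb
      have hk0 : k = 0 := by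
        rw [hk, min_eq_right (by exact_mod_cast hb), max_eq_right (by exact_mod_cast ha)]
      refine ⟨z, hz, ?_⟩
      rw [hu_eq]
      refine Lp.ext ?_
      filter_upwards [Lp.coeFn_add (toL2 z) (hconst.toLp _), hconst.coeFn_toLp] with x h1 h2
      rw [h1, Pi.add_apply, h2, hk0, add_zero]
  · have huq : u = q := by
      have h := hvar (u - (u - q)) (by simp [Uad])
      rw [sub_sub_cancel_left, inner_neg_right, real_inner_self_eq_norm_sq] at h
      exact sub_eq_zero.1 (norm_eq_zero.1 (pow_eq_zero_iff two_ne_zero |>.1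
        (le_antisymm (by linarith) (sq_nonneg _))))
    exact ⟨⟨y, huq.symm⟩, fun _ _ => ⟨y, y.2, huq.symm⟩⟩
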